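/- For $1\le p<\infty$, let $H_p^{\pm}$ be the Hardy space of the upper/lower half-plane $\mathbb C^{\pm}$, that is, the analytic functions $F$ on $\mathbb C^\pm$ with $\sup_{y>0}\int_{\mathbb R}|F(x\pm iy)|^p\,dx<\infty$. It is identified with a subspace of $L_p(\mathbb R)$ through the boundary function $f=\lim_{y\to0^+}F(\cdot\pm iy)$ (limit in $L_p$). Let $\mathcal H_p^{\pm}=\{(\xi\pm i)h(\xi): h\in H_p^{\pm}\}$. Functions on $\mathbb R$ are identified when they agree almost everywhere. For $j,s\in\,]1,\infty[$ with $\frac1j+\frac1s\le1$, a canonical $(j,s)$-factorization of a function $g$ on $\mathbb R$ is a representation $g=g_-g_+$ with almost everywhere non-zero factors such that $$g_-\in\mathcal H_j^-,\quad g_-^{-1}\in\mathcal H_s^-,\quad g_+\in\mathcal H_s^+,\quad g_+^{-1}\in\mathcal H_j^+ .$$ **Theorem.** Let $a=a_-a_+$ be a canonical $(p,q)$-factorization, and let $a=bc$, where $b=b_-b_+$ is a canonical $(m,l)$-factorization and $c=c_-c_+$ is a canonical $(j,s)$-factorization (so that each of the pairs $(p,q)$, $(m,l)$, $(j,s)$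 satisfies the conditions on exponents above). Suppose that $$\frac1l+\frac1s=\frac1{p'},\qquad \frac1m+\frac1j=\frac1{q'},\qquad\text{where } \frac1p+\frac1{p'}=1=\frac1q+\frac1{q'} .$$ Then $a=(b_-c_-)(b_+c_+)$ is a canonical $(p,q)$-factorization of $a$, and it coincides with $a=a_-a_+$ up to constants: there is $C\in\mathbb C\setminus\{0\}$ such that $a_-=C\,b_-c_-$ and $a_+=C^{-1}\,b_+c_+$ almost everywhere on $\mathbb R$. -/

import Mathlib

open MeasureTheory Filter Topology

/-- The Hardy space `H^p` of the upper half-plane, identified with a space of functions on the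
real line: `f ∈ L^p(ℝ)` is the boundary function (limit in `L^p` norm of the horizontal slices)
of a function `F` that is analytic for `Im z > 0` and has uniformly bounded `L^p` norms on
horizontal lines. -/
def HardyPlus (p : ℝ) : Set (ℝ → ℂ) :=
  {f | MemLp f (ENNReal.ofReal p) volume ∧
    ∃ F : ℂ → ℂ, DifferentiableOn ℂ F {z : ℂ | 0 < z.im} ∧
      (∃ M : NNReal, ∀ y : ℝ, 0 < y →
        eLpNorm (fun x : ℝ => F ((x : ℂ) + (y : ℂ) * Complex.I)) (ENNReal.ofReal p) volume ≤ M) ∧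
      Tendsto (fun y : ℝ =>
          eLpNorm (fun x : ℝ => F ((x : ℂ) + (y : ℂ) * Complex.I) - f x)
            (ENNReal.ofReal p) volume) (𝓝[>] (0 : ℝ)) (𝓝 0)}

/-- The Hardy space `H^p` of the lower half-plane, identified with its boundary functions. -/
def HardyMinus (p : ℝ) : Set (ℝ → ℂ) :=
  {f | MemLp f (ENNReal.ofReal p) volume ∧
    ∃ F : ℂ → ℂ, DifferentiableOn ℂ F {z : ℂ | z.im < 0} ∧
      (∃ M : NNReal, ∀ y : ℝ, 0 < y →
        eLpNorm (fun x : ℝ => F ((x : ℂ) - (y : ℂ) * Complex.I)) (ENNReal.ofReal p) volume ≤ M) ∧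
      Tendsto (fun y : ℝ =>
          eLpNorm (fun x : ℝ => F ((x : ℂ) - (y : ℂ) * Complex.I) - f x)
            (ENNReal.ofReal p) volume) (𝓝[>] (0 : ℝ)) (𝓝 0)}

/-- The space `λ₊ H_p^+`, where `λ₊(ξ) = ξ + i`. -/
def ScriptHardyPlus (p : ℝ) : Set (ℝ → ℂ) :=
  {f | ∃ h ∈ HardyPlus p, ∀ ξ : ℝ, f ξ = ((ξ : ℂ) + Complex.I) * h ξ}

/-- The space `λ₋ H_p^-`, where `λ₋(ξ) = ξ - i`. -/
def ScriptHardyMinus (p : ℝ) : Set (ℝ → ℂ) :=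
  {f | ∃ h ∈ HardyMinus p, ∀ ξ : ℝ, f ξ = ((ξ : ℂ) - Complex.I) * h ξ}

/-- `g = g₋ r^k g₊` (almost everywhere on `ℝ`, `r(ξ) = (ξ - i)/(ξ + i)`) is a
`(j,s)`-factorization of `g` with index `k`.  The factors are required to be nonzero almost
everywhere, so that the pointwise inverses are genuine inverses. -/
structure IsJSFactorization (j s : ℝ) (g gm : ℝ → ℂ) (k : ℤ) (gp : ℝ → ℂ) : Prop where
  one_lt_j : 1 < j
  one_lt_s : 1 < s
  exponents : 1 / j + 1 / s ≤ 1
  minus_ne_zero : ∀ᵐ ξ : ℝ, gm ξ ≠ 0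
  plus_ne_zero : ∀ᵐ ξ : ℝ, gp ξ ≠ 0
  eq_ae : ∀ᵐ ξ : ℝ,
    g ξ = gm ξ * (((ξ : ℂ) - Complex.I) / ((ξ : ℂ) + Complex.I)) ^ k * gp ξ
  minus_mem : gm ∈ ScriptHardyMinus j
  minus_inv_mem : (fun ξ => (gm ξ)⁻¹) ∈ ScriptHardyMinus s
  plus_mem : gp ∈ ScriptHardyPlus s
  plus_inv_mem : (fun ξ => (gp ξ)⁻¹) ∈ ScriptHardyPlus j

/-- `g = g₋ g₊` is a canonical `(j,s)`-factorization: a `(j,s)`-factorization with index `0`. -/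
def IsCanonicalJSFactorization (j s : ℝ) (g gm gp : ℝ → ℂ) : Prop :=
  IsJSFactorization j s g gm 0 gp

/-! By the two factorizations of `a`, the quotient `a₋ b₋⁻¹ c₋⁻¹` equals `b₊ c₊ a₊⁻¹` almost
everywhere. Since `1/p + 1/l + 1/s = 1`, Hölder places the first expression in `λ₋³ H_1^-` and the
second in `λ₊³ H_1^+`. A function in both spaces is a polynomial. Since `1/q + 1/m + 1/j = 1`, the
reciprocal is a polynomial too, so both are nonzero constants. Hence `b₋c₋` and `b₊c₊` are multiples
of `a₋` and `a₊` and inherit their memberships; Hölder alone would leave an extra factor `λ±`.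

The polynomial statement (`exists_polynomial_of_hardyPlus_of_hardyMinus`) rests on Cauchy integrals
of boundary values. At `w` in the upper half-plane, the `H_1^+` boundary function `f` reproduces its
extension `F`, and the `H_1^-` function `g` gives zero. Thus `2πi (w+i)³F(w)` is the integral of
`((w+i)³f(t) - (w-i)³g(t))/(t-w)`. The relation `(t+i)³f = (t-i)³g` lets `t-w` cancel, leaving a
quadratic polynomial in `w`. -/

/-! ### Products and reflections in Hardy spaces -/

theorem continuous_slice {F : ℂ → ℂ} (hF : DifferentiableOn ℂ F {z : ℂ | 0 < z.im}) {y : ℝ}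
    (hy : 0 < y) : Continuous (fun x : ℝ => F ((x : ℂ) + (y : ℂ) * Complex.I)) :=
  hF.continuousOn.comp_continuous (by fun_prop) (fun x => by simpa using hy)

/-- Hölder applied to `FG - fg = F(G - g) + (F - f)g`; only `F` needs a uniform bound. -/
theorem tendsto_eLpNorm_mul_sub {ι α : Type*} [MeasurableSpace α] {μ : Measure α} {l : Filter ι}
    {p q r : ENNReal} [ENNReal.HolderTriple p q r] (hr : 1 ≤ r) {F G : ι → α → ℂ} {f g : α → ℂ}
    {M : NNReal} (hF : ∀ᶠ i in l, AEStronglyMeasurable (F i) μ)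
    (hG : ∀ᶠ i in l, AEStronglyMeasurable (G i) μ)
    (hf : MemLp f p μ) (hg : MemLp g q μ) (hM : ∀ᶠ i in l, eLpNorm (F i) p μ ≤ M)
    (hFf : Tendsto (fun i => eLpNorm (fun x => F i x - f x) p μ) l (𝓝 0))
    (hGg : Tendsto (fun i => eLpNorm (fun x => G i x - g x) q μ) l (𝓝 0)) :
    Tendsto (fun i => eLpNorm (fun x => F i x * G i x - f x * g x) r μ) l (𝓝 0) := by
  have hlim : Tendsto (fun i => (M : ENNReal) * eLpNorm (fun x => G i x - g x) q μ
      + eLpNorm (fun x => F i x - f x) p μ * eLpNorm g q μ) l (𝓝 0) := by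
    have h1 := ENNReal.Tendsto.const_mul (a := (M : ENNReal)) hGg (Or.inr ENNReal.coe_ne_top)
    have h2 := ENNReal.Tendsto.mul_const (b := eLpNorm g q μ) hFf (Or.inr hg.2.ne)
    simpa using h1.add h2
  refine tendsto_of_tendsto_of_tendsto_of_le_of_le' tendsto_const_nhds hlim
    (Eventually.of_forall fun _ => zero_le) ?_
  filter_upwards [hF, hG, hM] with i hFi hGi hMi
  have e : (fun x => F i x * G i x - f x * g x)
      = (F i • (fun x => G i x - g x)) + ((fun x => F i x - f x) • g) := by
    ext x; simp; ring
  rw [e]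
  have m1 : AEStronglyMeasurable (fun x => G i x - g x) μ := hGi.sub hg.1
  have m2 : AEStronglyMeasurable (fun x => F i x - f x) μ := hFi.sub hf.1
  refine (eLpNorm_add_le (hFi.smul m1) (m2.smul hg.1) hr).trans (add_le_add ?_ ?_)
  · exact (eLpNorm_smul_le_mul_eLpNorm (p := p) (q := q) m1 hFi).trans (by gcongr)
  · exact eLpNorm_smul_le_mul_eLpNorm (p := p) (q := q) hg.1 m2

theorem holderTriple_ofReal {p q r : ℝ} (hp : 0 < p) (hq : 0 < q)
    (h : 1 / p + 1 / q = 1 / r) :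
    ENNReal.HolderTriple (ENNReal.ofReal p) (ENNReal.ofReal q) (ENNReal.ofReal r) := by
  have hr : 0 < r := by
    have : 0 < 1 / r := by rw [← h]; positivity
    exact one_div_pos.mp this
  constructor
  rw [← ENNReal.ofReal_inv_of_pos hp, ← ENNReal.ofReal_inv_of_pos hq,
    ← ENNReal.ofReal_inv_of_pos hr, ← ENNReal.ofReal_add (by positivity) (by positivity)]
  simp only [one_div] at h
  rw [h]

theorem HardyPlus.mul {p q r : ℝ} (hp : 0 < p) (hq : 0 < q) (hr : 1 ≤ r)
    (h : 1 / p + 1 / q = 1 / r) {f g : ℝ → ℂ} (hf : f ∈ HardyPlus p) (hg : g ∈ HardyPlus q) :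
    (fun x => f x * g x) ∈ HardyPlus r := by
  obtain ⟨hfL, F, hF, ⟨M, hM⟩, hFt⟩ := hf
  obtain ⟨hgL, G, hG, ⟨N, hN⟩, hGt⟩ := hg
  have := holderTriple_ofReal hp hq h
  refine ⟨MemLp.mul (p := ENNReal.ofReal p) (q := ENNReal.ofReal q) hgL hfL,
    fun z => F z * G z, hF.mul hG, ⟨M * N, fun y hy => ?_⟩, ?_⟩
  · push_cast
    exact (eLpNorm_smul_le_mul_eLpNorm (p := ENNReal.ofReal p) (q := ENNReal.ofReal q)
      (continuous_slice hG hy).aestronglyMeasurable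
      (continuous_slice hF hy).aestronglyMeasurable).trans (mul_le_mul' (hM y hy) (hN y hy))
  · have hpos : ∀ᶠ y : ℝ in 𝓝[>] 0, 0 < y := self_mem_nhdsWithin
    exact tendsto_eLpNorm_mul_sub (p := ENNReal.ofReal p) (q := ENNReal.ofReal q)
      (by simpa using hr)
      (hpos.mono fun y hy => (continuous_slice hF hy).aestronglyMeasurable)
      (hpos.mono fun y hy => (continuous_slice hG hy).aestronglyMeasurable)
      hfL hgL (hpos.mono fun y hy => hM y hy) hFt hGt

theorem eLpNorm_comp_neg_real {p : ENNReal} {f : ℝ → ℂ} (hf : AEStronglyMeasurable f volume) :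
    eLpNorm (fun x => f (-x)) p volume = eLpNorm f p volume :=
  eLpNorm_comp_measurePreserving hf (Measure.measurePreserving_neg volume)

/-- The reflection `z ↦ -z` exchanges the half-planes, so results for the lower one follow from
those for the upper one. -/
theorem HardyMinus.comp_neg {p : ℝ} {f : ℝ → ℂ} (hf : f ∈ HardyMinus p) :
    (fun x => f (-x)) ∈ HardyPlus p := by
  obtain ⟨hfL, F, hF, ⟨M, hM⟩, hFt⟩ := hf
  have hd : DifferentiableOn ℂ (fun z => F (-z)) {z : ℂ | 0 < z.im} :=
    hF.comp (by fun_prop) (fun z hz => by simpa using hz)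
  have e : ∀ x y : ℝ, -((x : ℂ) + y * Complex.I) = ((-x : ℝ) : ℂ) - y * Complex.I := by
    intro x y; push_cast; ring
  have hc : ∀ y : ℝ, 0 < y → Continuous (fun x : ℝ => F ((x : ℂ) - (y : ℂ) * Complex.I)) := by
    intro y hy
    exact hF.continuousOn.comp_continuous (by fun_prop) (fun x => by simpa using hy)
  refine ⟨hfL.comp_measurePreserving (Measure.measurePreserving_neg volume),
    fun z => F (-z), hd, ⟨M, fun y hy => ?_⟩, ?_⟩
  · simp only [e]
    rw [eLpNorm_comp_neg_real (f := fun x : ℝ => F ((x : ℂ) - (y : ℂ) * Complex.I))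
      (hc y hy).aestronglyMeasurable]
    exact hM y hy
  · refine hFt.congr' ?_
    filter_upwards [self_mem_nhdsWithin] with y hy
    simp only [e]
    exact (eLpNorm_comp_neg_real (f := fun x : ℝ => F ((x : ℂ) - (y : ℂ) * Complex.I) - f x)
      ((hc y hy).aestronglyMeasurable.sub hfL.1)).symm

theorem HardyPlus.mul_mul {p q r : ℝ} (hp : 0 < p) (hq : 0 < q) (hr : 1 < r)
    (h : 1 / p + 1 / q + 1 / r = 1) {f g k : ℝ → ℂ} (hf : f ∈ HardyPlus p) (hg : g ∈ HardyPlus q)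
    (hk : k ∈ HardyPlus r) : (fun x => f x * g x * k x) ∈ HardyPlus 1 := by
  have h1 : 0 < 1 / p + 1 / q := by positivity
  have h2 : 1 / p + 1 / q < 1 := by
    have : 0 < 1 / r := by positivity
    linarith
  have h3 : 1 ≤ (1 / p + 1 / q)⁻¹ := (one_le_inv₀ h1).2 h2.le
  have := HardyPlus.mul hp hq h3 (by simp) hf hg
  exact HardyPlus.mul (by positivity) (by positivity) le_rfl (by simpa using h) this hk

/-! ### Contour shifts and Cauchy's formula across the real line -/

/-- Cauchy's theorem on rectangles, without pointwise decay: by Tonelli the vertical-side integrals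
`φ R` are integrable in `R`, so they cannot stay bounded below as `R → ∞`. The norm bound is needed
only for `|x| > R₀`, which leaves room for a removed singularity. -/
theorem integral_eq_of_strip {F : ℂ → ℂ} {y₁ y₂ R₀ : ℝ} (hy : y₁ ≤ y₂) (M : NNReal)
    (hF : DifferentiableOn ℂ F {z : ℂ | z.im ∈ Set.Icc y₁ y₂})
    (h₁ : Integrable (fun x : ℝ => F ((x : ℂ) + (y₁ : ℂ) * Complex.I)))
    (h₂ : Integrable (fun x : ℝ => F ((x : ℂ) + (y₂ : ℂ) * Complex.I)))
    (hM : ∀ y ∈ Set.Icc y₁ y₂,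
      ∫⁻ x in {x : ℝ | R₀ < |x|}, ‖F ((x : ℂ) + (y : ℂ) * Complex.I)‖ₑ ≤ M) :
    ∫ x : ℝ, F ((x : ℂ) + (y₁ : ℂ) * Complex.I) = ∫ x : ℝ, F ((x : ℂ) + (y₂ : ℂ) * Complex.I) := by
  set φ : ℝ → ENNReal := fun R => ∫⁻ y in Set.Icc y₁ y₂, ‖F ((R : ℂ) + (y : ℂ) * Complex.I)‖ₑ
    with hφ
  have hS : MeasurableSet {x : ℝ | R₀ < |x|} :=
    (isOpen_lt continuous_const continuous_abs).measurableSet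
  have hmeas : AEMeasurable
      (Function.uncurry fun (R y : ℝ) => ‖F ((R : ℂ) + (y : ℂ) * Complex.I)‖ₑ)
      ((volume.restrict {x : ℝ | R₀ < |x|}).prod (volume.restrict (Set.Icc y₁ y₂))) := by
    rw [Measure.prod_restrict]
    have : ContinuousOn (Function.uncurry fun (R y : ℝ) => ‖F ((R : ℂ) + (y : ℂ) * Complex.I)‖ₑ)
        ({x : ℝ | R₀ < |x|} ×ˢ Set.Icc y₁ y₂) := by
      refine continuous_enorm.comp_continuousOn (hF.continuousOn.comp (by fun_prop) ?_)
      rintro ⟨a, b⟩ ⟨-, hb⟩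
      simpa using hb
    exact this.aemeasurable (hS.prod measurableSet_Icc)
  have hφfin : ∫⁻ R in {x : ℝ | R₀ < |x|}, φ R ≠ ⊤ := by
    rw [hφ, lintegral_lintegral_swap]
    · refine ((setLIntegral_mono measurable_const hM).trans_lt ?_).ne
      simp only [lintegral_const, Measure.restrict_apply_univ, Real.volume_Icc]
      exact ENNReal.mul_lt_top ENNReal.coe_lt_top ENNReal.ofReal_lt_top
    · exact hmeas
  have hrect : ∀ R : ℝ, ‖(∫ x in (-R)..R, F ((x : ℂ) + (y₁ : ℂ) * Complex.I))
      - ∫ x in (-R)..R, F ((x : ℂ) + (y₂ : ℂ) * Complex.I)‖ₑ ≤ φ R + φ (-R) := by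
    intro R
    have hb : ∀ R : ℝ, ‖Complex.I • ∫ y in y₁..y₂, F ((R : ℂ) + (y : ℂ) * Complex.I)‖ₑ ≤ φ R := by
      intro R
      rw [enorm_smul, intervalIntegral.integral_of_le hy]
      have hI : ‖Complex.I‖ₑ = 1 := by rw [← ofReal_norm]; simp
      rw [hI, one_mul]
      exact (enorm_integral_le_lintegral_enorm _).trans
        (lintegral_mono_set Set.Ioc_subset_Icc_self)
    have key := Complex.integral_boundary_rect_eq_zero_of_differentiableOn F
      (⟨-R, y₁⟩ : ℂ) (⟨R, y₂⟩ : ℂ) (hF.mono (by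
        intro z hz
        have := hz.2
        simpa [Set.uIcc_of_le hy] using this))
    simp only at key
    have key' : (∫ x in (-R)..R, F ((x : ℂ) + (y₁ : ℂ) * Complex.I))
      - ∫ x in (-R)..R, F ((x : ℂ) + (y₂ : ℂ) * Complex.I)
      = Complex.I • (∫ y in y₁..y₂, F (((-R : ℝ) : ℂ) + (y : ℂ) * Complex.I))
        - Complex.I • ∫ y in y₁..y₂, F ((R : ℂ) + (y : ℂ) * Complex.I) := by
      linear_combination key
    rw [key', add_comm (φ R)]
    exact (enorm_sub_le).trans (add_le_add (hb _) (hb _))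
  have hlim : Tendsto (fun R : ℝ => ‖(∫ x in (-R)..R, F ((x : ℂ) + (y₁ : ℂ) * Complex.I))
      - ∫ x in (-R)..R, F ((x : ℂ) + (y₂ : ℂ) * Complex.I)‖ₑ) atTop
      (𝓝 ‖(∫ x : ℝ, F ((x : ℂ) + (y₁ : ℂ) * Complex.I))
        - ∫ x : ℝ, F ((x : ℂ) + (y₂ : ℂ) * Complex.I)‖ₑ) :=
    ((intervalIntegral_tendsto_integral h₁ tendsto_neg_atTop_atBot tendsto_id).sub
      (intervalIntegral_tendsto_integral h₂ tendsto_neg_atTop_atBot tendsto_id)).enorm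
  -- If the integrals differed, `φ R + φ (-R)` would exceed some `c > 0` for all large `R`,
  -- contradicting integrability.
  by_contra hne
  have hpos : 0 < ‖(∫ x : ℝ, F ((x : ℂ) + (y₁ : ℂ) * Complex.I))
        - ∫ x : ℝ, F ((x : ℂ) + (y₂ : ℂ) * Complex.I)‖ₑ := by
    simpa [pos_iff_ne_zero, sub_eq_zero] using hne
  obtain ⟨c, hc0, hc⟩ := exists_between hpos
  obtain ⟨R₁, hR₁⟩ := eventually_atTop.1 (hlim.eventually (lt_mem_nhds hc))
  have hsub : Set.Ioi (max R₀ R₁) ⊆ {x : ℝ | R₀ < |x|} := fun x hx =>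
    lt_of_lt_of_le ((le_max_left _ _).trans_lt hx) (le_abs_self x)
  have hneg : ∫⁻ R in {x : ℝ | R₀ < |x|}, φ (-R) = ∫⁻ R in {x : ℝ | R₀ < |x|}, φ R := by
    have := (Measure.measurePreserving_neg (volume : Measure ℝ)).setLIntegral_comp_preimage_emb
      (MeasurableEquiv.neg ℝ).measurableEmbedding φ {x : ℝ | R₀ < |x|}
    simpa using this
  have : (⊤ : ENNReal) ≤ 2 * ∫⁻ R in {x : ℝ | R₀ < |x|}, φ R := by
    calc (⊤ : ENNReal) = ∫⁻ R in Set.Ioi (max R₀ R₁), c := by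
          simp [ENNReal.mul_top hc0.ne']
      _ ≤ ∫⁻ R in Set.Ioi (max R₀ R₁), (φ R + φ (-R)) := by
          refine setLIntegral_mono' measurableSet_Ioi fun R hR => ?_
          exact (hR₁ R ((le_max_right _ _).trans hR.le)).le.trans (hrect R)
      _ ≤ ∫⁻ R in {x : ℝ | R₀ < |x|}, (φ R + φ (-R)) := lintegral_mono_set hsub
      _ = _ := by
          have hφm : AEMeasurable φ (volume.restrict {x : ℝ | R₀ < |x|}) :=
            hmeas.lintegral_prod_right'
          rw [lintegral_add_left' hφm, hneg, two_mul]
  exact (ENNReal.mul_lt_top (by simp) hφfin.lt_top).ne (top_le_iff.1 this)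

theorem integrable_inv_sq_add_sq (a : ℝ) {b : ℝ} (hb : 0 < b) :
    Integrable (fun x : ℝ => ((x - a) ^ 2 + b ^ 2)⁻¹) ∧
      ∫ x : ℝ, ((x - a) ^ 2 + b ^ 2)⁻¹ = Real.pi / b := by
  have e : (fun x : ℝ => ((x - a) ^ 2 + b ^ 2)⁻¹)
      = fun x => (b ^ 2)⁻¹ * (1 + ((x - a) / b) ^ 2)⁻¹ := by
    ext x
    rw [← mul_inv]
    congr 1
    field_simp
    ring
  rw [e]
  constructor
  · exact ((integrable_inv_one_add_sq.comp_div hb.ne').comp_sub_right a).const_mul _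
  · rw [integral_const_mul, integral_sub_right_eq_self (fun x => (1 + (x / b) ^ 2)⁻¹) a,
      Measure.integral_comp_div (fun x => (1 + x ^ 2)⁻¹) b, integral_univ_inv_one_add_sq,
      abs_of_pos hb, smul_eq_mul]
    field_simp

theorem norm_add_mul_I_sub_sq (x y : ℝ) (w : ℂ) :
    ‖(x : ℂ) + (y : ℂ) * Complex.I - w‖ ^ 2 = (x - w.re) ^ 2 + (y - w.im) ^ 2 := by
  rw [Complex.sq_norm, Complex.normSq_apply]
  simp; ring

/-- Cauchy's integral formula for a function that is analytic on a neighbourhood of the closed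
upper half-plane and uniformly integrable along horizontal lines. -/
theorem integral_div_sub_eq {V : ℂ → ℂ} {ε : ℝ} (hε : 0 < ε)
    (hV : DifferentiableOn ℂ V {z : ℂ | -ε < z.im}) {M : ℝ}
    (hVi : ∀ y : ℝ, 0 ≤ y → Integrable (fun x : ℝ => V ((x : ℂ) + (y : ℂ) * Complex.I)))
    (hM : ∀ y : ℝ, 0 ≤ y → ∫ x : ℝ, ‖V ((x : ℂ) + (y : ℂ) * Complex.I)‖ ≤ M)
    {w : ℂ} (hw : 0 < w.im) :
    ∫ t : ℝ, V t / ((t : ℂ) - w) = 2 * Real.pi * Complex.I * V w := by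
  have hM0 : 0 ≤ M := (integral_nonneg fun _ => norm_nonneg _).trans (hM 0 le_rfl)
  set wc : ℂ := (starRingEnd ℂ) w with hwc
  set f : ℂ → ℂ := fun z => V z - V w * ((w - wc) / (z - wc)) with hf
  set S : Set ℂ := {z : ℂ | max (-ε) (-w.im) < z.im} with hS
  have hSo : IsOpen S := isOpen_lt continuous_const Complex.continuous_im
  have hS0 : ∀ z : ℂ, 0 ≤ z.im → z ∈ S := fun z hz =>
    (max_lt (by linarith) (by linarith) : max (-ε) (-w.im) < 0).trans_le hz
  have hne : ∀ z ∈ S, z - wc ≠ 0 := by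
    intro z hz h
    have h1 : -w.im < z.im := (le_max_right _ _).trans_lt hz
    have h2 : z = wc := sub_eq_zero.1 h
    rw [h2, hwc, Complex.conj_im] at h1
    exact lt_irrefl _ h1
  have hwS : w ∈ S := hS0 w hw.le
  have hfw : f w = 0 := by
    simp only [hf]; rw [div_self (hne w hwS)]; ring
  have hfd : DifferentiableOn ℂ f S := by
    refine (hV.mono fun z (hz : max (-ε) (-w.im) < z.im) => (le_max_left _ _).trans_lt hz).sub ?_
    exact (DifferentiableOn.div (by fun_prop) (by fun_prop) hne).const_mul _
  set F : ℂ → ℂ := dslope f w with hFdef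
  have hFd : DifferentiableOn ℂ F S := (Complex.differentiableOn_dslope (hSo.mem_nhds hwS)).2 hfd
  have hFeq : ∀ z, z ≠ w → F z = f z / (z - w) := by
    intro z hz
    rw [hFdef, dslope_of_ne f hz, slope_def_field, hfw, sub_zero]
  set C : ℝ := ‖V w * (w - wc)‖ with hC
  have hC0 : 0 ≤ C := norm_nonneg _
  have hbound : ∀ (x y δ : ℝ), 0 ≤ y → 0 < δ →
      δ ≤ ‖(x : ℂ) + (y : ℂ) * Complex.I - w‖ →
      ‖F ((x : ℂ) + (y : ℂ) * Complex.I)‖ ≤ ‖V ((x : ℂ) + (y : ℂ) * Complex.I)‖ / δ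
        + C * ((x - w.re) ^ 2 + (y - w.im) ^ 2)⁻¹ := by
    intro x y δ hy hδ hz
    have hcz : ‖(x : ℂ) + (y : ℂ) * Complex.I - w‖ ≤ ‖(x : ℂ) + (y : ℂ) * Complex.I - wc‖ := by
      refine le_of_sq_le_sq ?_ (norm_nonneg _)
      rw [norm_add_mul_I_sub_sq, norm_add_mul_I_sub_sq, hwc, Complex.conj_re, Complex.conj_im]
      nlinarith
    have hsq := norm_add_mul_I_sub_sq x y w
    set z : ℂ := (x : ℂ) + (y : ℂ) * Complex.I
    have hzpos : 0 < ‖z - w‖ := hδ.trans_le hz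
    have hzw : z ≠ w := fun h => by simp [h] at hzpos
    have e : F z = V z / (z - w) - (V w * (w - wc)) / ((z - wc) * (z - w)) := by
      rw [hFeq z hzw, hf]
      simp only
      rw [sub_div, ← mul_div_assoc, div_div]
    rw [e, ← hsq]
    refine (norm_sub_le _ _).trans (add_le_add ?_ ?_)
    · rw [norm_div]; gcongr
    · rw [norm_div, norm_mul (z - wc), ← hC, div_eq_mul_inv]
      gcongr
      rw [sq]
      gcongr
  have hFc : ∀ y : ℝ, 0 ≤ y → Continuous (fun x : ℝ => F ((x : ℂ) + (y : ℂ) * Complex.I)) := by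
    intro y hy
    exact hFd.continuousOn.comp_continuous (by fun_prop) (fun x => hS0 _ (by simpa using hy))
  have hdist : ∀ x y : ℝ, |y - w.im| ≤ ‖(x : ℂ) + (y : ℂ) * Complex.I - w‖ := by
    intro x y
    have := Complex.abs_im_le_norm ((x : ℂ) + (y : ℂ) * Complex.I - w)
    simpa using this
  have hmaj : ∀ y : ℝ, 0 ≤ y → y ≠ w.im →
      Integrable (fun x : ℝ => ‖V ((x : ℂ) + (y : ℂ) * Complex.I)‖ / |y - w.im|
        + C * ((x - w.re) ^ 2 + (y - w.im) ^ 2)⁻¹) ∧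
      ∫ x : ℝ, (‖V ((x : ℂ) + (y : ℂ) * Complex.I)‖ / |y - w.im|
        + C * ((x - w.re) ^ 2 + (y - w.im) ^ 2)⁻¹) ≤ (M + C * Real.pi) / |y - w.im| := by
    intro y hy hyw
    have hd : 0 < |y - w.im| := abs_pos.2 (sub_ne_zero.2 hyw)
    have hK := integrable_inv_sq_add_sq w.re hd
    simp only [sq_abs] at hK
    have i1 : Integrable (fun x : ℝ => ‖V ((x : ℂ) + (y : ℂ) * Complex.I)‖ / |y - w.im|) :=
      (hVi y hy).norm.div_const _
    refine ⟨i1.add (hK.1.const_mul C), ?_⟩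
    rw [integral_add i1 (hK.1.const_mul C), integral_const_mul, hK.2, integral_div, add_div,
      mul_div_assoc]
    gcongr
    exact hM y hy
  have hFi : ∀ y : ℝ, 0 ≤ y → y ≠ w.im →
      Integrable (fun x : ℝ => F ((x : ℂ) + (y : ℂ) * Complex.I)) := by
    intro y hy hyw
    exact (hmaj y hy hyw).1.mono' (hFc y hy).aestronglyMeasurable (Eventually.of_forall fun x =>
      hbound x y _ hy (abs_pos.2 (sub_ne_zero.2 hyw)) (hdist x y))
  have hFint : ∀ y : ℝ, 0 ≤ y → y ≠ w.im →
      ‖∫ x : ℝ, F ((x : ℂ) + (y : ℂ) * Complex.I)‖ ≤ (M + C * Real.pi) / |y - w.im| := by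
    intro y hy hyw
    exact (norm_integral_le_of_norm_le (hmaj y hy hyw).1 (Eventually.of_forall fun x =>
      hbound x y _ hy (abs_pos.2 (sub_ne_zero.2 hyw)) (hdist x y))).trans (hmaj y hy hyw).2
  have hshift : ∀ Y : ℝ, w.im < Y → ∫ x : ℝ, F ((x : ℂ) + ((0 : ℝ) : ℂ) * Complex.I)
      = ∫ x : ℝ, F ((x : ℂ) + (Y : ℂ) * Complex.I) := by
    intro Y hY
    -- For `|x| > |Re w| + 1` the distance to `w` is at least `1` at every height, so the bound is
    -- uniform even on the line through `w`. There `(x - Re w)² + 1 ≤ 2(x - Re w)²`, whence the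
    -- factor `2 * C`.
    have hK := integrable_inv_sq_add_sq w.re one_pos
    refine integral_eq_of_strip (R₀ := |w.re| + 1) (hw.trans hY).le
      (M + 2 * C * Real.pi).toNNReal (hFd.mono fun z hz => hS0 z hz.1)
      (hFi 0 le_rfl hw.ne) (hFi Y (hw.trans hY).le hY.ne') ?_
    intro y hy
    have i1 : Integrable (fun x : ℝ => ‖V ((x : ℂ) + (y : ℂ) * Complex.I)‖
        + 2 * C * ((x - w.re) ^ 2 + 1 ^ 2)⁻¹) :=
      (hVi y hy.1).norm.add (hK.1.const_mul _)
    calc ∫⁻ x in {x : ℝ | |w.re| + 1 < |x|}, ‖F ((x : ℂ) + (y : ℂ) * Complex.I)‖ₑ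
        ≤ ∫⁻ x in {x : ℝ | |w.re| + 1 < |x|}, ENNReal.ofReal
            (‖V ((x : ℂ) + (y : ℂ) * Complex.I)‖ + 2 * C * ((x - w.re) ^ 2 + 1 ^ 2)⁻¹) := by
          refine setLIntegral_mono' (isOpen_lt continuous_const continuous_abs).measurableSet ?_
          intro x hx
          rw [← ofReal_norm]
          refine ENNReal.ofReal_le_ofReal ?_
          have h1 : 1 ≤ |x - w.re| := by
            have h2 : |w.re| + 1 < |x| := hx
            have := abs_sub_abs_le_abs_sub x w.re
            linarith
          have h1s : 1 ≤ (x - w.re) ^ 2 := by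
            rw [← sq_abs]; nlinarith
          have h3 : 1 ≤ ‖(x : ℂ) + (y : ℂ) * Complex.I - w‖ := by
            refine h1.trans ?_
            have := Complex.abs_re_le_norm ((x : ℂ) + (y : ℂ) * Complex.I - w)
            simpa using this
          refine (hbound x y 1 hy.1 one_pos h3).trans ?_
          rw [div_one, mul_comm 2 C, mul_assoc]
          gcongr
          rw [← div_eq_mul_inv, inv_le_comm₀ (by positivity) (by positivity), inv_div]
          nlinarith [sq_nonneg (y - w.im)]
      _ ≤ ∫⁻ x : ℝ, ENNReal.ofReal
            (‖V ((x : ℂ) + (y : ℂ) * Complex.I)‖ + 2 * C * ((x - w.re) ^ 2 + 1 ^ 2)⁻¹) :=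
          setLIntegral_le_lintegral _ _
      _ = ENNReal.ofReal (∫ x : ℝ, (‖V ((x : ℂ) + (y : ℂ) * Complex.I)‖
            + 2 * C * ((x - w.re) ^ 2 + 1 ^ 2)⁻¹)) :=
          (ofReal_integral_eq_lintegral_ofReal i1
            (Eventually.of_forall fun x => by positivity)).symm
      _ ≤ ENNReal.ofReal (M + 2 * C * Real.pi) := by
          refine ENNReal.ofReal_le_ofReal ?_
          rw [integral_add (hVi y hy.1).norm (hK.1.const_mul _), integral_const_mul, hK.2, div_one]
          gcongr
          exact hM y hy.1
  -- The integral does not depend on the height `Y > Im w` and is `O(1 / |Y - Im w|)`.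
  have hzero : ∫ x : ℝ, F ((x : ℂ) + ((0 : ℝ) : ℂ) * Complex.I) = 0 := by
    have hl : Tendsto (fun Y : ℝ => (M + C * Real.pi) / |Y - w.im|) atTop (𝓝 0) :=
      tendsto_const_nhds.div_atTop
        (tendsto_abs_atTop_atTop.comp (tendsto_atTop_add_const_right _ (-w.im) tendsto_id))
    have h2 : ‖∫ x : ℝ, F ((x : ℂ) + ((0 : ℝ) : ℂ) * Complex.I)‖ ≤ 0 := by
      refine ge_of_tendsto hl ?_
      filter_upwards [eventually_gt_atTop w.im] with Y hY
      rw [hshift Y hY]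
      exact hFint Y (hw.trans hY).le hY.ne'
    exact norm_le_zero_iff.1 h2
  have hK := integrable_inv_sq_add_sq w.re hw
  have hKc : Integrable (fun x : ℝ => V w * (w - wc) * (((x - w.re) ^ 2 + w.im ^ 2)⁻¹ : ℝ)) :=
    hK.1.ofReal.const_mul _
  -- On the real line the correction is a multiple of the Poisson kernel, whose explicit integral
  -- gives `2πi V w`.
  have hsplit : ∀ t : ℝ, V t / ((t : ℂ) - w) = F ((t : ℂ) + ((0 : ℝ) : ℂ) * Complex.I)
      + V w * (w - wc) * (((t - w.re) ^ 2 + w.im ^ 2)⁻¹ : ℝ) := by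
    intro t
    have hz : ((t : ℂ) + ((0 : ℝ) : ℂ) * Complex.I) = t := by simp
    have htw : (t : ℂ) ≠ w := by
      intro h; rw [← h] at hw; simp at hw
    have ht1 : (t : ℂ) - w ≠ 0 := sub_ne_zero.2 htw
    have ht2 : (t : ℂ) - wc ≠ 0 := hne _ (hS0 _ (by simp))
    have e : ((((t - w.re) ^ 2 + w.im ^ 2)⁻¹ : ℝ) : ℂ) = (((t : ℂ) - w) * ((t : ℂ) - wc))⁻¹ := by
      rw [Complex.ofReal_inv]
      congr 1
      apply Complex.ext <;> simp [hwc, sq]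
      ring
    rw [hz, hFeq _ htw, e, hf]
    simp only
    field_simp
    ring
  simp_rw [hsplit]
  rw [integral_add (hFi 0 le_rfl hw.ne) hKc, hzero, zero_add, integral_const_mul, integral_complex_ofReal,
    hK.2]
  have e2 : w - wc = 2 * w.im * Complex.I := by
    rw [hwc, Complex.sub_conj]; push_cast; ring
  have hwne : (w.im : ℂ) ≠ 0 := by exact_mod_cast hw.ne'
  rw [e2]
  push_cast
  field_simp

/-- The Cauchy integral of the boundary values vanishes at points of the lower half-plane. -/
theorem integral_div_sub_eq_zero {V : ℂ → ℂ} {ε : ℝ} (hε : 0 < ε)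
    (hV : DifferentiableOn ℂ V {z : ℂ | -ε < z.im}) {M : ℝ}
    (hVi : ∀ y : ℝ, 0 ≤ y → Integrable (fun x : ℝ => V ((x : ℂ) + (y : ℂ) * Complex.I)))
    (hM : ∀ y : ℝ, 0 ≤ y → ∫ x : ℝ, ‖V ((x : ℂ) + (y : ℂ) * Complex.I)‖ ≤ M)
    {w : ℂ} (hw : w.im < 0) :
    ∫ t : ℝ, V t / ((t : ℂ) - w) = 0 := by
  set wc : ℂ := (starRingEnd ℂ) w with hwc
  set δ : ℝ := min ε (-w.im) with hδ
  have hne : ∀ z : ℂ, -δ < z.im → z - w ≠ 0 := by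
    intro z hz h
    rw [sub_eq_zero.1 h] at hz
    have := min_le_right ε (-w.im)
    linarith
  -- The factor has modulus at most `1` on the closed upper half-plane and vanishes at `wc`.
  -- Cauchy's formula for `G` at `wc` therefore gives zero, while `G t / (t - wc) = V t / (t - w)`
  -- on the line.
  set G : ℂ → ℂ := fun z => V z * ((z - wc) / (z - w)) with hG
  have hδ0 : 0 < δ := lt_min hε (by linarith)
  have hGd : DifferentiableOn ℂ G {z : ℂ | -δ < z.im} := by
    refine (hV.mono fun z (hz : -δ < z.im) => ?_).mul
      (DifferentiableOn.div (by fun_prop) (by fun_prop) hne)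
    exact (neg_le_neg (min_le_left _ _)).trans_lt hz
  have hGV : ∀ x y : ℝ, 0 ≤ y → ‖G ((x : ℂ) + (y : ℂ) * Complex.I)‖
      ≤ ‖V ((x : ℂ) + (y : ℂ) * Complex.I)‖ := by
    intro x y hy
    simp only [hG, norm_mul, norm_div]
    refine mul_le_of_le_one_right (norm_nonneg _) (div_le_one_of_le₀ ?_ (norm_nonneg _))
    refine le_of_sq_le_sq ?_ (norm_nonneg _)
    rw [norm_add_mul_I_sub_sq, norm_add_mul_I_sub_sq, hwc, Complex.conj_re, Complex.conj_im]
    nlinarith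
  have hGc : ∀ y : ℝ, 0 ≤ y → Continuous (fun x : ℝ => G ((x : ℂ) + (y : ℂ) * Complex.I)) := by
    intro y hy
    refine hGd.continuousOn.comp_continuous (by fun_prop) (fun x => ?_)
    simp; linarith
  have hGi : ∀ y : ℝ, 0 ≤ y → Integrable (fun x : ℝ => G ((x : ℂ) + (y : ℂ) * Complex.I)) :=
    fun y hy => (hVi y hy).mono (hGc y hy).aestronglyMeasurable
      (Eventually.of_forall fun x => hGV x y hy)
  have key := integral_div_sub_eq (w := wc) hδ0 hGd hGi
    (fun y hy => (integral_mono (hGi y hy).norm (hVi y hy).norm fun x => hGV x y hy).trans (hM y hy))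
    (by rw [hwc, Complex.conj_im]; linarith)
  have hz : G wc = 0 := by simp [hG]
  rw [hz, mul_zero] at key
  rw [← key]
  refine integral_congr_ae (Eventually.of_forall fun t => ?_)
  have h1 : (t : ℂ) - w ≠ 0 := hne _ (by simpa using hδ0)
  have h2 : (t : ℂ) - wc ≠ 0 := by
    intro h
    have h3 := congrArg Complex.im (sub_eq_zero.1 h)
    rw [hwc, Complex.conj_im, Complex.ofReal_im] at h3
    linarith
  simp only [hG]
  field_simp

/-! ### Cauchy integrals of boundary functions -/

theorem norm_inv_ofReal_sub_le (t : ℝ) {w : ℂ} (hw : w.im ≠ 0) :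
    ‖((t : ℂ) - w)⁻¹‖ ≤ |w.im|⁻¹ := by
  have h := Complex.abs_im_le_norm ((t : ℂ) - w)
  simp only [Complex.sub_im, Complex.ofReal_im, zero_sub, abs_neg] at h
  rw [norm_inv]
  exact inv_anti₀ (abs_pos.2 hw) h

theorem ofReal_sub_ne_zero (t : ℝ) {w : ℂ} (hw : w.im ≠ 0) : (t : ℂ) - w ≠ 0 := by
  intro h
  rw [← sub_eq_zero.1 h] at hw
  simp at hw

theorem continuous_inv_ofReal_sub {w : ℂ} (hw : w.im ≠ 0) :
    Continuous fun t : ℝ => ((t : ℂ) - w)⁻¹ :=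
  Continuous.inv₀ (by fun_prop) fun t => ofReal_sub_ne_zero t hw

theorem integrable_div_ofReal_sub {f : ℝ → ℂ} (hf : Integrable f) {w : ℂ} (hw : w.im ≠ 0) :
    Integrable fun t : ℝ => f t / ((t : ℂ) - w) := by
  simp only [div_eq_mul_inv]
  exact hf.mul_bdd (c := |w.im|⁻¹) (continuous_inv_ofReal_sub hw).aestronglyMeasurable
    (Eventually.of_forall fun t => norm_inv_ofReal_sub_le t hw)

theorem tendsto_integral_div_ofReal_sub {ι : Type*} {l : Filter ι} {G : ι → ℝ → ℂ} {f : ℝ → ℂ}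
    (hf : Integrable f) (hG : ∀ᶠ i in l, Integrable (G i))
    (hGf : Tendsto (fun i => eLpNorm (fun x => G i x - f x) 1 volume) l (𝓝 0))
    {w : ℂ} (hw : w.im ≠ 0) :
    Tendsto (fun i => ∫ t : ℝ, G i t / ((t : ℂ) - w)) l (𝓝 (∫ t : ℝ, f t / ((t : ℂ) - w))) := by
  refine tendsto_integral_of_L1 _ (integrable_div_ofReal_sub hf hw).aestronglyMeasurable
    (hG.mono fun i hi => integrable_div_ofReal_sub hi hw) ?_
  have h0 := ENNReal.Tendsto.const_mul (a := ENNReal.ofReal |w.im|⁻¹) hGf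
    (Or.inr ENNReal.ofReal_ne_top)
  rw [mul_zero] at h0
  refine tendsto_of_tendsto_of_tendsto_of_le_of_le tendsto_const_nhds h0
    (fun _ => zero_le) fun i => ?_
  simp only [eLpNorm_one_eq_lintegral_enorm]
  rw [← lintegral_const_mul' _ _ ENNReal.ofReal_ne_top]
  refine lintegral_mono fun t => ?_
  rw [← sub_div, div_eq_mul_inv, enorm_mul, mul_comm]
  gcongr
  rw [← ofReal_norm]
  exact ENNReal.ofReal_le_ofReal (norm_inv_ofReal_sub_le t hw)

/-- The shift `F(· + iy)` is analytic past the real line, so the preceding formulas apply to it; `y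
→ 0` passes through the integral because the kernel is bounded by `1/|Im w|`. Convergence in `L^1`
gives almost everywhere convergence only along a sequence of heights, which suffices to recover `f`
from `F`. -/
theorem HardyPlus.exists_cauchy {f : ℝ → ℂ} (hf : f ∈ HardyPlus 1) :
    Integrable f ∧ ∃ F : ℂ → ℂ,
      (∃ u : ℕ → ℝ, Tendsto u atTop (𝓝[>] 0) ∧
        ∀ᵐ x : ℝ, Tendsto (fun n => F ((x : ℂ) + (u n : ℂ) * Complex.I)) atTop (𝓝 (f x))) ∧
      (∀ w : ℂ, 0 < w.im →
        ∫ t : ℝ, f t / ((t : ℂ) - w) = 2 * Real.pi * Complex.I * F w) ∧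
      ∀ w : ℂ, w.im < 0 → ∫ t : ℝ, f t / ((t : ℂ) - w) = 0 := by
  obtain ⟨hfL, F, hF, ⟨M, hM⟩, hFt⟩ := hf
  rw [ENNReal.ofReal_one] at hfL hM hFt
  have hfi : Integrable f := memLp_one_iff_integrable.1 hfL
  have hFi : ∀ y : ℝ, 0 < y → Integrable (fun x : ℝ => F ((x : ℂ) + (y : ℂ) * Complex.I)) :=
    fun y hy => memLp_one_iff_integrable.1
      ⟨(continuous_slice hF hy).aestronglyMeasurable, (hM y hy).trans_lt ENNReal.coe_lt_top⟩
  have hFM : ∀ y : ℝ, 0 < y → ∫ x : ℝ, ‖F ((x : ℂ) + (y : ℂ) * Complex.I)‖ ≤ M := by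
    intro y hy
    rw [integral_norm_eq_lintegral_enorm (hFi y hy).1]
    refine ENNReal.toReal_le_of_le_ofReal M.2 ?_
    have := hM y hy
    rw [eLpNorm_one_eq_lintegral_enorm] at this
    simpa using this
  have hpos : ∀ᶠ y : ℝ in 𝓝[>] 0, 0 < y := self_mem_nhdsWithin
  have hlim : ∀ w : ℂ, w.im ≠ 0 → Tendsto
      (fun y : ℝ => ∫ t : ℝ, F ((t : ℂ) + (y : ℂ) * Complex.I) / ((t : ℂ) - w)) (𝓝[>] 0)
      (𝓝 (∫ t : ℝ, f t / ((t : ℂ) - w))) := fun w hw =>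
    tendsto_integral_div_ofReal_sub hfi (hpos.mono hFi) hFt hw
  have hsh : ∀ y : ℝ, 0 < y →
      DifferentiableOn ℂ (fun z => F (z + (y : ℂ) * Complex.I)) {z : ℂ | -y < z.im} :=
    fun y hy => hF.comp (by fun_prop) fun z (hz : -y < z.im) => by
      simp only [Set.mem_ofPred_eq, Complex.add_im, Complex.mul_im, Complex.ofReal_re,
        Complex.I_im, Complex.ofReal_im, Complex.I_re]
      linarith
  have he : ∀ x y y' : ℝ, (x : ℂ) + (y' : ℂ) * Complex.I + (y : ℂ) * Complex.I
      = (x : ℂ) + ((y' + y : ℝ) : ℂ) * Complex.I := by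
    intro x y y'; push_cast; ring
  have hshi : ∀ y : ℝ, 0 < y → ∀ y' : ℝ, 0 ≤ y' → Integrable (fun x : ℝ =>
      F ((x : ℂ) + (y' : ℂ) * Complex.I + (y : ℂ) * Complex.I)) := by
    intro y hy y' hy'
    simp only [he]
    exact hFi _ (by linarith)
  have hshM : ∀ y : ℝ, 0 < y → ∀ y' : ℝ, 0 ≤ y' → ∫ x : ℝ,
      ‖F ((x : ℂ) + (y' : ℂ) * Complex.I + (y : ℂ) * Complex.I)‖ ≤ M := by
    intro y hy y' hy'
    simp only [he]
    exact hFM _ (by linarith)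
  refine ⟨hfi, F, ?_, fun w hw => ?_, fun w hw => ?_⟩
  · have hu : Tendsto (fun n : ℕ => 1 / ((n : ℝ) + 1)) atTop (𝓝[>] 0) :=
      tendsto_nhdsWithin_iff.2 ⟨tendsto_one_div_add_atTop_nhds_zero_nat,
        Eventually.of_forall fun n => by simp only [Set.mem_Ioi]; positivity⟩
    have hmeas := tendstoInMeasure_of_tendsto_eLpNorm (p := 1) one_ne_zero
      (f := fun (n : ℕ) (x : ℝ) => F ((x : ℂ) + ((1 / ((n : ℝ) + 1) : ℝ) : ℂ) * Complex.I)) (g := f)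
      (μ := volume) (l := atTop)
      (fun n => (hFi _ (by positivity)).1) hfi.1 (hFt.comp hu)
    obtain ⟨ns, hns, hae⟩ := hmeas.exists_seq_tendsto_ae
    exact ⟨_, hu.comp hns.tendsto_atTop, hae⟩
  · refine tendsto_nhds_unique (hlim w hw.ne') ?_
    have hc : Tendsto (fun y : ℝ => 2 * Real.pi * Complex.I * F (w + (y : ℂ) * Complex.I)) (𝓝[>] 0)
        (𝓝 (2 * Real.pi * Complex.I * F w)) := by
      refine Tendsto.const_mul _ ?_
      have hFw : ContinuousAt F w := (hF.differentiableAt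
        ((isOpen_lt continuous_const Complex.continuous_im).mem_nhds hw)).continuousAt
      have h1 : Tendsto (fun y : ℝ => w + (y : ℂ) * Complex.I) (𝓝[>] 0) (𝓝 w) := by
        have : Continuous (fun y : ℝ => w + (y : ℂ) * Complex.I) := by fun_prop
        have h2 := this.tendsto 0
        simp only [Complex.ofReal_zero, zero_mul, add_zero] at h2
        exact h2.mono_left nhdsWithin_le_nhds
      exact hFw.tendsto.comp h1
    refine hc.congr' ?_
    filter_upwards [hpos] with y hy
    exact (integral_div_sub_eq hy (hsh y hy) (hshi y hy) (hshM y hy) hw).symm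
  · refine tendsto_nhds_unique (hlim w hw.ne) (tendsto_const_nhds.congr' ?_)
    filter_upwards [hpos] with y hy
    exact (integral_div_sub_eq_zero hy (hsh y hy) (hshi y hy) (hshM y hy) hw).symm

theorem HardyMinus.integral_div_ofReal_sub_eq_zero {g : ℝ → ℂ} (hg : g ∈ HardyMinus 1) {w : ℂ}
    (hw : 0 < w.im) : ∫ t : ℝ, g t / ((t : ℂ) - w) = 0 := by
  obtain ⟨-, -, -, -, h⟩ := HardyPlus.exists_cauchy (HardyMinus.comp_neg hg)
  have h0 := h (-w) (by simpa using hw)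
  rw [← integral_neg_eq_self, ← neg_eq_zero, ← integral_neg, ← h0]
  refine integral_congr_ae (Eventually.of_forall fun t => ?_)
  simp only
  rw [← div_neg]
  congr 1
  push_cast; ring

/-! ### Functions in both weighted spaces are polynomials -/

theorem ofReal_add_I_ne_zero (t : ℝ) : (t : ℂ) + Complex.I ≠ 0 := by
  intro h
  simpa using congrArg Complex.im h

theorem ofReal_sub_I_ne_zero (t : ℝ) : (t : ℂ) - Complex.I ≠ 0 := by
  intro h
  simpa using congrArg Complex.im h

theorem integrable_mul_pow_div_add_I {g : ℝ → ℂ} (hg : Integrable g) {k : ℕ} (hk : k ≤ 3) :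
    Integrable fun t : ℝ => g t * ((t : ℂ) ^ k / ((t : ℂ) + Complex.I) ^ 3) := by
  refine hg.mul_bdd (c := 1) (Continuous.aestronglyMeasurable ?_) (Eventually.of_forall fun t => ?_)
  · exact Continuous.div (by fun_prop) (by fun_prop) fun t => pow_ne_zero _ (ofReal_add_I_ne_zero t)
  · have h1 : ‖(t : ℂ)‖ ≤ ‖(t : ℂ) + Complex.I‖ := by
      simpa using Complex.abs_re_le_norm ((t : ℂ) + Complex.I)
    have h2 : 1 ≤ ‖(t : ℂ) + Complex.I‖ := by
      simpa using Complex.abs_im_le_norm ((t : ℂ) + Complex.I)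
    rw [norm_div, norm_pow, norm_pow]
    refine div_le_one_of_le₀ ?_ (by positivity)
    exact (pow_le_pow_left₀ (norm_nonneg _) h1 k).trans (pow_le_pow_right₀ h2 hk)

/-- A function in `λ₊³ H_1^+ ∩ λ₋³ H_1^-` is a polynomial. -/
theorem exists_polynomial_of_hardyPlus_of_hardyMinus {f g : ℝ → ℂ} (hf : f ∈ HardyPlus 1)
    (hg : g ∈ HardyMinus 1)
    (hfg : ∀ᵐ x : ℝ, ((x : ℂ) + Complex.I) ^ 3 * f x = ((x : ℂ) - Complex.I) ^ 3 * g x) :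
    ∃ P : Polynomial ℂ, ∀ᵐ x : ℝ, ((x : ℂ) + Complex.I) ^ 3 * f x = P.eval (x : ℂ) := by
  obtain ⟨hfi, F, ⟨u, hu, huF⟩, hF, -⟩ := HardyPlus.exists_cauchy hf
  have hgi : Integrable g := memLp_one_iff_integrable.1 (by simpa using hg.1)
  set A : ℕ → ℂ := fun k => ∫ t : ℝ, g t * ((t : ℂ) ^ k / ((t : ℂ) + Complex.I) ^ 3) with hA
  -- This is `((3w² - 1)A₂ + 8wA₁ + (3 - w²)A₀)/π`, collected in powers of `w`.
  set P : Polynomial ℂ := Polynomial.C ((Real.pi : ℂ)⁻¹) *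
    (Polynomial.C (3 * A 2 - A 0) * Polynomial.X ^ 2 + Polynomial.C (8 * A 1) * Polynomial.X
      + Polynomial.C (3 * A 0 - A 2)) with hP
  have hFP : ∀ w : ℂ, 0 < w.im → (w + Complex.I) ^ 3 * F w = P.eval w := by
    intro w hw
    have i0 := integrable_mul_pow_div_add_I hgi (k := 0) (by norm_num)
    have i1 := integrable_mul_pow_div_add_I hgi (k := 1) (by norm_num)
    have i2 := integrable_mul_pow_div_add_I hgi (k := 2) (by norm_num)
    have h1 : (w + Complex.I) ^ 3 * (2 * Real.pi * Complex.I * F w)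
        = 2 * Complex.I * ((3 * w ^ 2 - 1) * A 2 + 8 * w * A 1 + (3 - w ^ 2) * A 0) := by
      calc (w + Complex.I) ^ 3 * (2 * Real.pi * Complex.I * F w)
          = (w + Complex.I) ^ 3 * (∫ t : ℝ, f t / ((t : ℂ) - w))
            - (w - Complex.I) ^ 3 * ∫ t : ℝ, g t / ((t : ℂ) - w) := by
            rw [hF w hw, HardyMinus.integral_div_ofReal_sub_eq_zero hg hw, mul_zero, sub_zero]
        _ = ∫ t : ℝ, ((w + Complex.I) ^ 3 * (f t / ((t : ℂ) - w))
            - (w - Complex.I) ^ 3 * (g t / ((t : ℂ) - w))) := by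
            rw [integral_sub ((integrable_div_ofReal_sub hfi hw.ne').const_mul _)
              ((integrable_div_ofReal_sub hgi hw.ne').const_mul _), integral_const_mul,
              integral_const_mul]
        _ = ∫ t : ℝ, 2 * Complex.I * (
            (3 * w ^ 2 - 1) * (g t * ((t : ℂ) ^ 2 / ((t : ℂ) + Complex.I) ^ 3))
            + 8 * w * (g t * ((t : ℂ) ^ 1 / ((t : ℂ) + Complex.I) ^ 3))
            + (3 - w ^ 2) * (g t * ((t : ℂ) ^ 0 / ((t : ℂ) + Complex.I) ^ 3))) := by
            refine integral_congr_ae ?_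
            filter_upwards [hfg] with t ht
            have n1 := ofReal_add_I_ne_zero t
            have n2 := ofReal_sub_ne_zero t hw.ne'
            have hft : f t = ((t : ℂ) - Complex.I) ^ 3 * g t / ((t : ℂ) + Complex.I) ^ 3 := by
              rw [← ht, mul_div_cancel_left₀ _ (pow_ne_zero _ n1)]
            have hI : Complex.I ^ 2 = -1 := Complex.I_sq
            -- With `x = tw + 1` and `d = i(t - w)`, the left side is `(x + d)³ - (x - d)³ = 2d(3x²
            -- + d²)`, which is divisible by `t - w`.
            have hα : (w + Complex.I) ^ 3 * ((t : ℂ) - Complex.I) ^ 3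
                - (w - Complex.I) ^ 3 * ((t : ℂ) + Complex.I) ^ 3
                = 2 * Complex.I * ((t : ℂ) - w) *
                  ((3 * w ^ 2 - 1) * (t : ℂ) ^ 2 + 8 * w * t + (3 - w ^ 2)) := by
              have e1 : (w + Complex.I) * ((t : ℂ) - Complex.I)
                  = t * w + 1 + Complex.I * (t - w) := by linear_combination -hI
              have e2 : (w - Complex.I) * ((t : ℂ) + Complex.I)
                  = t * w + 1 - Complex.I * (t - w) := by linear_combination -hI
              rw [← mul_pow, ← mul_pow, e1, e2]
              linear_combination 2 * Complex.I * ((t : ℂ) - w) ^ 3 * hI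
            rw [hft]
            field_simp
            linear_combination g t * hα
        _ = _ := by
            have i12 : Integrable fun t : ℝ =>
                (3 * w ^ 2 - 1) * (g t * ((t : ℂ) ^ 2 / ((t : ℂ) + Complex.I) ^ 3))
                + 8 * w * (g t * ((t : ℂ) ^ 1 / ((t : ℂ) + Complex.I) ^ 3)) :=
              (i2.const_mul _).add (i1.const_mul _)
            rw [integral_const_mul, integral_add i12
              (i0.const_mul _), integral_add (i2.const_mul _) (i1.const_mul _),
              integral_const_mul, integral_const_mul, integral_const_mul]
    have hpi : (Real.pi : ℂ) ≠ 0 := by exact_mod_cast Real.pi_ne_zero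
    have h2 : (Real.pi : ℂ) * ((w + Complex.I) ^ 3 * F w)
        = (3 * w ^ 2 - 1) * A 2 + 8 * w * A 1 + (3 - w ^ 2) * A 0 := by
      refine mul_left_cancel₀ (mul_ne_zero two_ne_zero Complex.I_ne_zero) ?_
      linear_combination h1
    rw [hP]
    simp only [Polynomial.eval_mul, Polynomial.eval_add, Polynomial.eval_C, Polynomial.eval_pow,
      Polynomial.eval_X]
    rw [eq_inv_mul_iff_mul_eq₀ hpi, h2]
    ring
  refine ⟨P, ?_⟩
  filter_upwards [huF] with x hx
  have hux : Tendsto (fun n => (x : ℂ) + (u n : ℂ) * Complex.I) atTop (𝓝 (x : ℂ)) := by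
    have hc : Continuous (fun y : ℝ => (x : ℂ) + (y : ℂ) * Complex.I) := by fun_prop
    have h := (hc.tendsto 0).comp (hu.mono_right nhdsWithin_le_nhds)
    simpa [Function.comp_def] using h
  refine tendsto_nhds_unique (((hux.add_const Complex.I).pow 3).mul hx) ?_
  refine ((P.continuous.tendsto _).comp hux).congr' ?_
  filter_upwards [hu.eventually self_mem_nhdsWithin] with n hn
  exact (hFP _ (by simpa using hn)).symm

/-- Two polynomials whose values on the real line are almost everywhere inverse to each other
are constant. -/
theorem exists_const_of_mul_eval_eq_one {P Q : Polynomial ℂ}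
    (h : ∀ᵐ x : ℝ, P.eval (x : ℂ) * Q.eval (x : ℂ) = 1) :
    ∃ c : ℂ, c ≠ 0 ∧ P = Polynomial.C c := by
  -- A set of full measure in the line is infinite, so the identity holds for the polynomials and
  -- `P` is a unit.
  have hinf : {x : ℝ | P.eval (x : ℂ) * Q.eval (x : ℂ) = 1}.Infinite := by
    intro hfin
    have h0 : volume (Set.univ : Set ℝ) = 0 := by
      rw [← Set.union_compl_self {x : ℝ | P.eval (x : ℂ) * Q.eval (x : ℂ) = 1}]
      exact measure_union_null (hfin.measure_zero _) h
    simp at h0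
  have hPQ : P * Q = 1 := by
    refine Polynomial.eq_of_infinite_eval_eq _ _
      ((hinf.image Complex.ofReal_injective.injOn).mono ?_)
    rintro _ ⟨x, hx, rfl⟩
    simpa using hx
  obtain ⟨c, hc, hcP⟩ := Polynomial.isUnit_iff.1 (IsUnit.of_mul_eq_one _ hPQ)
  exact ⟨c, hc.ne_zero, hcP.symm⟩

/-! ### Invariance under null sets and constant multiples -/

theorem HardyPlus.congr_ae {p : ℝ} {f g : ℝ → ℂ} (hf : f ∈ HardyPlus p) (h : f =ᵐ[volume] g) :
    g ∈ HardyPlus p := by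
  obtain ⟨hfL, F, hF, hM, hFt⟩ := hf
  refine ⟨hfL.ae_eq h, F, hF, hM, hFt.congr fun y => eLpNorm_congr_ae ?_⟩
  filter_upwards [h] with x hx
  rw [hx]

theorem HardyMinus.congr_ae {p : ℝ} {f g : ℝ → ℂ} (hf : f ∈ HardyMinus p) (h : f =ᵐ[volume] g) :
    g ∈ HardyMinus p := by
  obtain ⟨hfL, F, hF, hM, hFt⟩ := hf
  refine ⟨hfL.ae_eq h, F, hF, hM, hFt.congr fun y => eLpNorm_congr_ae ?_⟩
  filter_upwards [h] with x hx
  rw [hx]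

theorem HardyPlus.comp_neg {p : ℝ} {f : ℝ → ℂ} (hf : f ∈ HardyPlus p) :
    (fun x => f (-x)) ∈ HardyMinus p := by
  obtain ⟨hfL, F, hF, ⟨M, hM⟩, hFt⟩ := hf
  have hd : DifferentiableOn ℂ (fun z => F (-z)) {z : ℂ | z.im < 0} :=
    hF.comp (by fun_prop) (fun z hz => by simpa using hz)
  have e : ∀ x y : ℝ, -((x : ℂ) - y * Complex.I) = ((-x : ℝ) : ℂ) + y * Complex.I := by
    intro x y; push_cast; ring
  refine ⟨hfL.comp_measurePreserving (Measure.measurePreserving_neg volume),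
    fun z => F (-z), hd, ⟨M, fun y hy => ?_⟩, ?_⟩
  · simp only [e]
    rw [eLpNorm_comp_neg_real (f := fun x : ℝ => F ((x : ℂ) + (y : ℂ) * Complex.I))
      (continuous_slice hF hy).aestronglyMeasurable]
    exact hM y hy
  · refine hFt.congr' ?_
    filter_upwards [self_mem_nhdsWithin] with y hy
    simp only [e]
    exact (eLpNorm_comp_neg_real (f := fun x : ℝ => F ((x : ℂ) + (y : ℂ) * Complex.I) - f x)
      ((continuous_slice hF hy).aestronglyMeasurable.sub hfL.1)).symm

theorem HardyMinus.mul_mul {p q r : ℝ} (hp : 0 < p) (hq : 0 < q) (hr : 1 < r)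
    (h : 1 / p + 1 / q + 1 / r = 1) {f g k : ℝ → ℂ} (hf : f ∈ HardyMinus p)
    (hg : g ∈ HardyMinus q) (hk : k ∈ HardyMinus r) :
    (fun x => f x * g x * k x) ∈ HardyMinus 1 := by
  simpa using HardyPlus.comp_neg
    (HardyPlus.mul_mul hp hq hr h (HardyMinus.comp_neg hf) (HardyMinus.comp_neg hg) (HardyMinus.comp_neg hk))

theorem HardyPlus.const_mul {p : ℝ} {f : ℝ → ℂ} (hf : f ∈ HardyPlus p) (c : ℂ) :
    (fun x => c * f x) ∈ HardyPlus p := by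
  obtain ⟨hfL, F, hF, ⟨M, hM⟩, hFt⟩ := hf
  refine ⟨hfL.const_mul c, fun z => c * F z, hF.const_mul c, ⟨‖c‖₊ * M, fun y hy => ?_⟩, ?_⟩
  · have := eLpNorm_const_smul_le (c := c) (p := ENNReal.ofReal p) (μ := volume)
      (f := fun x : ℝ => F ((x : ℂ) + (y : ℂ) * Complex.I))
    push_cast
    exact this.trans (mul_le_mul' le_rfl (hM y hy))
  · have h0 := ENNReal.Tendsto.const_mul (a := ‖c‖ₑ) hFt (Or.inr enorm_ne_top)
    rw [mul_zero] at h0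
    refine h0.congr fun y => ?_
    rw [← eLpNorm_const_smul]
    refine congrArg (fun f => eLpNorm f _ _) (funext fun x => ?_)
    simp [mul_sub]

theorem HardyMinus.const_mul {p : ℝ} {f : ℝ → ℂ} (hf : f ∈ HardyMinus p) (c : ℂ) :
    (fun x => c * f x) ∈ HardyMinus p := by
  simpa using HardyPlus.comp_neg (HardyPlus.const_mul (HardyMinus.comp_neg hf) c)

theorem ScriptHardyPlus.of_ae_eq_const_mul {p : ℝ} {f g : ℝ → ℂ} (hf : f ∈ ScriptHardyPlus p)
    (c : ℂ) (h : ∀ᵐ x : ℝ, g x = c * f x) : g ∈ ScriptHardyPlus p := by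
  obtain ⟨k, hk, hfk⟩ := hf
  -- `ScriptHardyPlus` demands equality at every point, so the witness is built from `g` and
  -- compared with `c * k` only almost everywhere.
  refine ⟨fun x => g x / ((x : ℂ) + Complex.I), HardyPlus.congr_ae (HardyPlus.const_mul hk c) ?_, fun x =>
    (mul_div_cancel₀ _ (ofReal_add_I_ne_zero x)).symm⟩
  filter_upwards [h] with x hx
  rw [hx, hfk]
  field_simp [ofReal_add_I_ne_zero x]

theorem ScriptHardyMinus.of_ae_eq_const_mul {p : ℝ} {f g : ℝ → ℂ} (hf : f ∈ ScriptHardyMinus p)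
    (c : ℂ) (h : ∀ᵐ x : ℝ, g x = c * f x) : g ∈ ScriptHardyMinus p := by
  obtain ⟨k, hk, hfk⟩ := hf
  refine ⟨fun x => g x / ((x : ℂ) - Complex.I), HardyMinus.congr_ae (HardyMinus.const_mul hk c) ?_, fun x =>
    (mul_div_cancel₀ _ (ofReal_sub_I_ne_zero x)).symm⟩
  filter_upwards [h] with x hx
  rw [hx, hfk]
  field_simp [ofReal_sub_I_ne_zero x]

/-! ### Comparison of the two factorizations -/

/-- If a product of three functions from the spaces `λ₋ H^-` with Hölder conjugate exponents agrees
with a product of three functions from the spaces `λ₊ H^+`, then it is a polynomial. -/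
theorem exists_polynomial_of_mul_eq_mul {p q r p' q' r' : ℝ} (hp : 0 < p) (hq : 0 < q) (hr : 1 < r)
    (hp' : 0 < p') (hq' : 0 < q') (hr' : 1 < r') (h : 1 / p + 1 / q + 1 / r = 1)
    (h' : 1 / p' + 1 / q' + 1 / r' = 1) {f₁ f₂ f₃ g₁ g₂ g₃ : ℝ → ℂ}
    (hf₁ : f₁ ∈ ScriptHardyMinus p) (hf₂ : f₂ ∈ ScriptHardyMinus q) (hf₃ : f₃ ∈ ScriptHardyMinus r)
    (hg₁ : g₁ ∈ ScriptHardyPlus p') (hg₂ : g₂ ∈ ScriptHardyPlus q') (hg₃ : g₃ ∈ ScriptHardyPlus r')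
    (hfg : ∀ᵐ x : ℝ, f₁ x * f₂ x * f₃ x = g₁ x * g₂ x * g₃ x) :
    ∃ P : Polynomial ℂ, ∀ᵐ x : ℝ, f₁ x * f₂ x * f₃ x = P.eval (x : ℂ) := by
  obtain ⟨a₁, ha₁, ea₁⟩ := hf₁
  obtain ⟨a₂, ha₂, ea₂⟩ := hf₂
  obtain ⟨a₃, ha₃, ea₃⟩ := hf₃
  obtain ⟨b₁, hb₁, eb₁⟩ := hg₁
  obtain ⟨b₂, hb₂, eb₂⟩ := hg₂
  obtain ⟨b₃, hb₃, eb₃⟩ := hg₃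
  obtain ⟨P, hP⟩ := exists_polynomial_of_hardyPlus_of_hardyMinus
    (HardyPlus.mul_mul hp' hq' hr' h' hb₁ hb₂ hb₃) (HardyMinus.mul_mul hp hq hr h ha₁ ha₂ ha₃) (by
      filter_upwards [hfg] with x hx
      rw [ea₁, ea₂, ea₃, eb₁, eb₂, eb₃] at hx
      linear_combination -hx)
  refine ⟨P, ?_⟩
  filter_upwards [hfg, hP] with x hx hPx
  rw [hx, ← hPx, eb₁, eb₂, eb₃]
  ring

theorem theorem6p4 (p q p' q' m l j s : ℝ)
    (hpp' : 1 / p + 1 / p' = 1) (hqq' : 1 / q + 1 / q' = 1)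
    (hls : 1 / l + 1 / s = 1 / p') (hmj : 1 / m + 1 / j = 1 / q')
    (a am ap b bm bp c cm cp : ℝ → ℂ)
    (ha : IsCanonicalJSFactorization p q a am ap)
    (hb : IsCanonicalJSFactorization m l b bm bp)
    (hc : IsCanonicalJSFactorization j s c cm cp)
    (habc : ∀ᵐ ξ : ℝ, a ξ = b ξ * c ξ) :
    IsCanonicalJSFactorization p q a (fun ξ => bm ξ * cm ξ) (fun ξ => bp ξ * cp ξ) ∧
      ∃ C : ℂ, C ≠ 0 ∧
        (∀ᵐ ξ : ℝ, am ξ = C * (bm ξ * cm ξ)) ∧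
        (∀ᵐ ξ : ℝ, ap ξ = C⁻¹ * (bp ξ * cp ξ)) := by
  have eqa : ∀ᵐ ξ : ℝ, a ξ = am ξ * ap ξ := by simpa using ha.eq_ae
  have eqb : ∀ᵐ ξ : ℝ, b ξ = bm ξ * bp ξ := by simpa using hb.eq_ae
  have eqc : ∀ᵐ ξ : ℝ, c ξ = cm ξ * cp ξ := by simpa using hc.eq_ae
  have hprod : ∀ᵐ ξ : ℝ, am ξ * ap ξ = bm ξ * bp ξ * (cm ξ * cp ξ) := by
    filter_upwards [eqa, eqb, eqc, habc] with ξ h1 h2 h3 h4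
    rw [← h1, ← h2, ← h3, h4]
  have hp := ha.one_lt_j
  have hq := ha.one_lt_s
  have hm := hb.one_lt_j
  have hl := hb.one_lt_s
  have hj := hc.one_lt_j
  have hs := hc.one_lt_s
  -- The quotient `a₋ b₋⁻¹ c₋⁻¹ = b₊ c₊ a₊⁻¹`; both sides have exponents `p, l, s`, with `1/l + 1/s
  -- = 1/p'`.
  obtain ⟨P, hP⟩ := exists_polynomial_of_mul_eq_mul (p := p) (q := l) (r := s)
    (p' := l) (q' := s) (r' := p) (by linarith) (by linarith) hs (by linarith) (by linarith) hp
    (by linarith) (by linarith) ha.minus_mem hb.minus_inv_mem hc.minus_inv_mem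
    hb.plus_mem hc.plus_mem ha.plus_inv_mem (by
      filter_upwards [hprod, ha.plus_ne_zero, hb.minus_ne_zero, hc.minus_ne_zero] with ξ h h1 h2 h3
      field_simp
      linear_combination h)
  -- The reciprocal `a₋⁻¹ b₋ c₋ = b₊⁻¹ c₊⁻¹ a₊`, with exponents `q, m, j` and `1/m + 1/j = 1/q'`.
  obtain ⟨Q, hQ⟩ := exists_polynomial_of_mul_eq_mul (p := q) (q := m) (r := j)
    (p' := m) (q' := j) (r' := q) (by linarith) (by linarith) hj (by linarith) (by linarith) hq
    (by linarith) (by linarith) ha.minus_inv_mem hb.minus_mem hc.minus_mem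
    hb.plus_inv_mem hc.plus_inv_mem ha.plus_mem (by
      filter_upwards [hprod, ha.minus_ne_zero, hb.plus_ne_zero, hc.plus_ne_zero] with ξ h h1 h2 h3
      field_simp
      linear_combination -h)
  obtain ⟨C, hC, rfl⟩ := exists_const_of_mul_eval_eq_one (P := P) (Q := Q) (by
    filter_upwards [hP, hQ, ha.minus_ne_zero, hb.minus_ne_zero, hc.minus_ne_zero]
      with ξ h1 h2 n1 n2 n3
    rw [← h1, ← h2]
    field_simp)
  have ham : ∀ᵐ ξ : ℝ, am ξ = C * (bm ξ * cm ξ) := by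
    filter_upwards [hP, hb.minus_ne_zero, hc.minus_ne_zero] with ξ h1 n2 n3
    rw [Polynomial.eval_C] at h1
    rw [← h1]
    field_simp
  have hap : ∀ᵐ ξ : ℝ, ap ξ = C⁻¹ * (bp ξ * cp ξ) := by
    filter_upwards [ham, hprod, hb.minus_ne_zero, hc.minus_ne_zero] with ξ h h1 n2 n3
    rw [h] at h1
    refine mul_left_cancel₀ (mul_ne_zero hC (mul_ne_zero n2 n3)) (h1.trans ?_)
    field_simp
  refine ⟨?_, C, hC, ham, hap⟩
  have hm' : ∀ᵐ ξ : ℝ, bm ξ * cm ξ = C⁻¹ * am ξ := by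
    filter_upwards [ham] with ξ h
    rw [h, inv_mul_cancel_left₀ hC]
  have hp' : ∀ᵐ ξ : ℝ, bp ξ * cp ξ = C * ap ξ := by
    filter_upwards [hap] with ξ h
    rw [h, mul_inv_cancel_left₀ hC]
  exact
    { one_lt_j := hp
      one_lt_s := hq
      exponents := ha.exponents
      minus_ne_zero := by
        filter_upwards [hb.minus_ne_zero, hc.minus_ne_zero] with ξ h1 h2 using mul_ne_zero h1 h2
      plus_ne_zero := by
        filter_upwards [hb.plus_ne_zero, hc.plus_ne_zero] with ξ h1 h2 using mul_ne_zero h1 h2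
      eq_ae := by
        filter_upwards [eqa, hprod] with ξ h1 h2
        rw [h1, h2, zpow_zero]
        ring
      minus_mem := ScriptHardyMinus.of_ae_eq_const_mul ha.minus_mem C⁻¹ hm'
      minus_inv_mem := ScriptHardyMinus.of_ae_eq_const_mul ha.minus_inv_mem C (by
        filter_upwards [hm'] with ξ h
        rw [h, mul_inv, inv_inv])
      plus_mem := ScriptHardyPlus.of_ae_eq_const_mul ha.plus_mem C hp'
      plus_inv_mem := ScriptHardyPlus.of_ae_eq_const_mul ha.plus_inv_mem C⁻¹ (by
        filter_upwards [hp'] with ξ h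
        rw [h, mul_inv]) }
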